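/- **Setting.** Let $(M_0,M)$ be a model of $V^0$ (the basic axioms of two-sorted arithmetic and $\Sigma^B_0$-comprehension; in particular any model of $VP$), with number sort $M_0$ and string sort $M$; the $i$-th row of a string $X$ is $X^{[i]}=\{j : \langle i,j\rangle\in X\}$. Let $\mathbb{B}$ be a Boolean algebra in $(M_0,M)$: its elements are the classes of the strings in a set of codes, and the set of codes and the preorder that $\mathbb{B}$ induces on it are first-order definable in $(M_0,M)$ with parameters. Let $M^{\mathbb{B}}$ be the set of all sequences $A:b\to\mathbb{B}$, $b\in M_0$, that are coded in $M$ (some $X\in M$ has, for each $i<b$, a code of $A(i)$ as its $i$-th row); put $A(i)=0$ for $i\ge b$. **Boolean values.** For a $\Sigma^B_0$ formula $\varphi(\bar x,\bar X)$, $\bar a,\bar c\in M_0$ and $A_i:b_i\to\mathbb{B}$ in $M^{\mathbb{B}}$, let $\langle\varphi\rangle_{\bar a,\bar c}(\bar A)\in\mathbb{B}$ be the propositional translation of $\varphi$ for numbers $\bar a$ and string lengths $\bar c$, evaluated at $\bar A$: atomic formulas in number terms (with $|X_i|$ read as $c_i$) get the value $1$ or $0$ according to their truth; $t\in X_i$ gets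 the value $A_i(t)$ if $t<c_i$ and $0$ otherwise; $X_i=X_j$ gets $\bigwedge_{y<c_i}(A_i(y)\leftrightarrow A_j(y))$ if $c_i=c_j$ and $0$ otherwise; connectives are those of $\mathbb{B}$; and $\exists y<t$, $\forall y<t$ become the least upper bound and the greatest lower bound over $y<t$. For $A:b\to\mathbb{B}$ let $[\![|A|=c]\!]$ be $A(c-1)\wedge\bigwedge_{c\le j<b}\neg A(j)$ (without the first conjunct if $c=0$), and let $$[\![\varphi(\bar a,\bar A)]\!]=\bigvee_{\bar c\le\bar b}\Big(\bigwedge_i[\![|A_i|=c_i]\!]\wedge\langle\varphi\rangle_{\bar a,\bar c}(\bar A)\Big).$$ $\mathbb{B}$ *admits a $\Sigma^B_0$-translation* if (i) every sequence in $M^{\mathbb{B}}$ has a least upper bound in $\mathbb{B}$, and the join defining $[\![\varphi(\bar a,\bar A)]\!]$ always exists; (ii) for every $\Sigma^B_0$ formula $\varphi(y,\bar x,\bar X)$, all $\bar a,d\in M_0$, $\bar A\in M^{\mathbb{B}}$ and $\bar c\le\bar b$, the sequence $(\langle\varphi\rangle_{j,\bar a,\bar c}(\bar A))_{j<d}$ is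 in $M^{\mathbb{B}}$; (iii) induction for strings is valid in $\mathbb{B}$: if $A:b\to\mathbb{B}$ is in $M^{\mathbb{B}}$, $c<b$, $v\in\mathbb{B}$, $v\le A(0)$ and $v\wedge A(i)\le A(i+1)$ for all $i<c$, then $v\le A(c)$. **Generic extension.** A proper ideal $I\subseteq\mathbb{B}$ is *$M_0$-complete* if it contains $\bigvee_{i<b}A(i)$ for every $A:b\to\mathbb{B}$ in $M^{\mathbb{B}}$ with all $A(i)\in I$. A set $D\subseteq\mathbb{B}$ is *dense over $I$* if for every $x\in\mathbb{B}\setminus I$ there is $y\in D\setminus I$ with $y\le x$. A proper filter $G\subseteq\mathbb{B}$ is *$\mathcal{M}$-generic over $I$* if $G\cap(D\setminus I)\ne\emptyset$ for every $D$ that is dense over $I$ and definable in $(M_0,M)$ with parameters. For $A:b\to\mathbb{B}$ let $i_G(A)=\{y<b : A(y)\in G\}$, and let $M[G]=\{i_G(A) : A\in M^{\mathbb{B}}\}$. In $(M_0,M[G])$ the number operations are those of $M_0$, $y\in X$ is membership, and $|X|$ is the least strict upper bound of $X$ in $M_0$. **Theorem** (Forcing Theorem for $\Sigma^B_0$ formulas).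 Suppose that $\mathbb{B}$ admits a $\Sigma^B_0$-translation and that $G$ is $\mathcal{M}$-generic over an $M_0$-complete ideal $I$. Then every $i_G(A)$ has a least strict upper bound in $M_0$, so that $(M_0,M[G])$ is a two-sorted structure, and for every $\Sigma^B_0$ formula $\varphi(\bar x,\bar X)$, all $\bar a\in M_0$ and all $\bar A\in M^{\mathbb{B}}$, $$(M_0,M[G])\models\varphi(\bar a,\overline{i_G(A)})\iff[\![\varphi(\bar a,\bar A)]\!]\in G.$$ Moreover, if $|i_G(A_i)|=b_i$ for every $A_i:b_i\to\mathbb{B}$ in $\bar A$, then $(M_0,M[G])\models\varphi(\bar a,\overline{i_G(A)})\iff\langle\varphi\rangle_{\bar a,\bar b}(\bar A)\in G$. -/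

import Mathlib

universe u v w

/-! ## The two-sorted language, its structures, and the theory `V⁰` -/

/-- A structure for the two-sorted language with number sort `N` and string sort `S`:
`0`, `s`, `+`, `·`, `≤` on numbers, the length `|X|` of a string, and the relation `X(i)`
(written `mem i X`). Both equality symbols are interpreted as equality. -/
structure TwoSorted (N : Type u) (S : Type v) where
  zero : N
  succ : N → N
  add : N → N → N
  mul : N → N → N
  le : N → N → Prop
  len : S → N
  mem : N → S → Prop

/-- Number terms with `k` free number variables and `l` free string variables. -/
inductive NumTerm : ℕ → ℕ → Type
  | var {k l : ℕ} (x : Fin k) : NumTerm k l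
  | len {k l : ℕ} (X : Fin l) : NumTerm k l
  | zero {k l : ℕ} : NumTerm k l
  | succ {k l : ℕ} (t : NumTerm k l) : NumTerm k l
  | add {k l : ℕ} (t u : NumTerm k l) : NumTerm k l
  | mul {k l : ℕ} (t u : NumTerm k l) : NumTerm k l

/-- `Σ₀ᴮ` formulas with `k` free number variables and `l` free string variables: the only
quantifiers are `∀ x < t` and `∃ x < t` over numbers. In `exLt t φ` and `allLt t φ` the bound
variable is the variable `0` of `φ`, and it does not occur in `t`. -/
inductive SigmaB0 : ℕ → ℕ → Type
  | le {k l : ℕ} (t u : NumTerm k l) : SigmaB0 k l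
  | eqNum {k l : ℕ} (t u : NumTerm k l) : SigmaB0 k l
  | eqStr {k l : ℕ} (X Y : Fin l) : SigmaB0 k l
  | mem {k l : ℕ} (t : NumTerm k l) (X : Fin l) : SigmaB0 k l
  | neg {k l : ℕ} (φ : SigmaB0 k l) : SigmaB0 k l
  | and {k l : ℕ} (φ ψ : SigmaB0 k l) : SigmaB0 k l
  | or {k l : ℕ} (φ ψ : SigmaB0 k l) : SigmaB0 k l
  | exLt {k l : ℕ} (t : NumTerm k l) (φ : SigmaB0 (k + 1) l) : SigmaB0 k l
  | allLt {k l : ℕ} (t : NumTerm k l) (φ : SigmaB0 (k + 1) l) : SigmaB0 k l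

/-- All first-order formulas of the two-sorted language: built from `Σ₀ᴮ` formulas (which
include the atomic ones) by connectives and unbounded quantifiers of both sorts. -/
inductive Formula2 : ℕ → ℕ → Type
  | base {k l : ℕ} (φ : SigmaB0 k l) : Formula2 k l
  | neg {k l : ℕ} (φ : Formula2 k l) : Formula2 k l
  | and {k l : ℕ} (φ ψ : Formula2 k l) : Formula2 k l
  | or {k l : ℕ} (φ ψ : Formula2 k l) : Formula2 k l
  | exNum {k l : ℕ} (φ : Formula2 (k + 1) l) : Formula2 k l
  | allNum {k l : ℕ} (φ : Formula2 (k + 1) l) : Formula2 k l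
  | exStr {k l : ℕ} (φ : Formula2 k (l + 1)) : Formula2 k l
  | allStr {k l : ℕ} (φ : Formula2 k (l + 1)) : Formula2 k l

/-- The value of a term when the number variables are `a` and the string variables have
lengths `n`. -/
def NumTerm.eval {N : Type u} {S : Type v} (M : TwoSorted N S) :
    {k l : ℕ} → NumTerm k l → (Fin k → N) → (Fin l → N) → N
  | _, _, .var x, a, _ => a x
  | _, _, .len X, _, n => n X
  | _, _, .zero, _, _ => M.zero
  | _, _, .succ t, a, n => M.succ (t.eval M a n)
  | _, _, .add t u, a, n => M.add (t.eval M a n) (u.eval M a n)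
  | _, _, .mul t u, a, n => M.mul (t.eval M a n) (u.eval M a n)

/-- Strict order: `x < y` abbreviates `x ≤ y ∧ x ≠ y`. -/
def TwoSorted.lt {N : Type u} {S : Type v} (M : TwoSorted N S) (x y : N) : Prop :=
  M.le x y ∧ x ≠ y

/-- Truth of a `Σ₀ᴮ` formula in a structure. -/
def SigmaB0.Sat {N : Type u} {S : Type v} (M : TwoSorted N S) :
    {k l : ℕ} → SigmaB0 k l → (Fin k → N) → (Fin l → S) → Prop
  | _, _, .le t u, a, A =>
      M.le (t.eval M a (fun i => M.len (A i))) (u.eval M a (fun i => M.len (A i)))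
  | _, _, .eqNum t u, a, A =>
      t.eval M a (fun i => M.len (A i)) = u.eval M a (fun i => M.len (A i))
  | _, _, .eqStr X Y, _, A => A X = A Y
  | _, _, .mem t X, a, A => M.mem (t.eval M a (fun i => M.len (A i))) (A X)
  | _, _, .neg φ, a, A => ¬ φ.Sat M a A
  | _, _, .and φ ψ, a, A => φ.Sat M a A ∧ ψ.Sat M a A
  | _, _, .or φ ψ, a, A => φ.Sat M a A ∨ ψ.Sat M a A
  | _, _, .exLt t φ, a, A =>
      ∃ j, M.lt j (t.eval M a (fun i => M.len (A i))) ∧ φ.Sat M (Fin.cons j a) A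
  | _, _, .allLt t φ, a, A =>
      ∀ j, M.lt j (t.eval M a (fun i => M.len (A i))) → φ.Sat M (Fin.cons j a) A

/-- Truth of a first-order formula in a structure. -/
def Formula2.Sat {N : Type u} {S : Type v} (M : TwoSorted N S) :
    {k l : ℕ} → Formula2 k l → (Fin k → N) → (Fin l → S) → Prop
  | _, _, .base φ, a, A => φ.Sat M a A
  | _, _, .neg φ, a, A => ¬ φ.Sat M a A
  | _, _, .and φ ψ, a, A => φ.Sat M a A ∧ ψ.Sat M a A
  | _, _, .or φ ψ, a, A => φ.Sat M a A ∨ ψ.Sat M a A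
  | _, _, .exNum φ, a, A => ∃ x : N, φ.Sat M (Fin.cons x a) A
  | _, _, .allNum φ, a, A => ∀ x : N, φ.Sat M (Fin.cons x a) A
  | _, _, .exStr φ, a, A => ∃ X : S, φ.Sat M a (Fin.cons X A)
  | _, _, .allStr φ, a, A => ∀ X : S, φ.Sat M a (Fin.cons X A)

/-- Models of `V⁰`: the basic axioms of the two-sorted language and comprehension for
`Σ₀ᴮ` formulas. -/
structure TwoSorted.IsModelV0 {N : Type u} {S : Type v} (M : TwoSorted N S) : Prop where
  succ_ne_zero : ∀ x, M.succ x ≠ M.zero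
  succ_inj : ∀ x y, M.succ x = M.succ y → x = y
  add_zero : ∀ x, M.add x M.zero = x
  add_succ : ∀ x y, M.add x (M.succ y) = M.succ (M.add x y)
  mul_zero : ∀ x, M.mul x M.zero = M.zero
  mul_succ : ∀ x y, M.mul x (M.succ y) = M.add (M.mul x y) x
  le_antisymm : ∀ x y, M.le x y → M.le y x → x = y
  le_add : ∀ x y, M.le x (M.add x y)
  zero_le : ∀ x, M.le M.zero x
  le_total : ∀ x y, M.le x y ∨ M.le y x
  le_iff_lt_succ : ∀ x y, M.le x y ↔ M.lt x (M.succ y)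
  exists_pred : ∀ x, x ≠ M.zero → ∃ y, M.le y x ∧ M.succ y = x
  lt_len : ∀ X y, M.mem y X → M.lt y (M.len X)
  mem_pred_len : ∀ X y, M.succ y = M.len X → M.mem y X
  ext : ∀ X Y, M.len X = M.len Y → (∀ i, M.lt i (M.len X) → (M.mem i X ↔ M.mem i Y)) → X = Y
  comprehension : ∀ (k l : ℕ) (φ : SigmaB0 (k + 1) l) (a : Fin k → N) (A : Fin l → S) (y : N),
    ∃ X, M.le (M.len X) y ∧ ∀ z, M.lt z y → (M.mem z X ↔ φ.Sat M (Fin.cons z a) A)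

/-- The pairing function `⟨x, y⟩ = (x + y)(x + y + 1) + 2y`. -/
def TwoSorted.pair {N : Type u} {S : Type v} (M : TwoSorted N S) (x y : N) : N :=
  M.add (M.mul (M.add x y) (M.succ (M.add x y))) (M.add y y)

/-- `W` is the `i`-th row of `X`, i.e. the `i`-th member of the sequence of strings coded
by `X`. -/
def TwoSorted.IsRow {N : Type u} {S : Type v} (M : TwoSorted N S) (X : S) (i : N) (W : S) :
    Prop :=
  ∀ j, M.mem j W ↔ M.mem (M.pair i j) X

/-- A set of strings that is first-order definable with parameters. -/
def TwoSorted.Definable {N : Type u} {S : Type v} (M : TwoSorted N S) (P : S → Prop) : Prop :=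
  ∃ (k l : ℕ) (φ : Formula2 k (l + 1)) (a : Fin k → N) (A : Fin l → S),
    ∀ X, P X ↔ φ.Sat M a (Fin.cons X A)

/-- A binary relation on strings that is first-order definable with parameters. -/
def TwoSorted.Definable₂ {N : Type u} {S : Type v} (M : TwoSorted N S) (P : S → S → Prop) :
    Prop :=
  ∃ (k l : ℕ) (φ : Formula2 k (l + 2)) (a : Fin k → N) (A : Fin l → S),
    ∀ X Y, P X Y ↔ φ.Sat M a (Fin.cons X (Fin.cons Y A))

/-! ## Boolean algebras in a structure, names, and Boolean values -/

/-- A presentation of the Boolean algebra `B` in `M`: the elements of `B` are the classes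
`cls X` of the strings `X` in a definable set `code` (such as the set of circuits), and the
preorder `cls X ≤ cls Y` on codes is definable. -/
structure BooleanAlgebraIn {N : Type u} {S : Type v} (M : TwoSorted N S) (B : Type w)
    [BooleanAlgebra B] where
  code : S → Prop
  cls : {X : S // code X} → B
  surjective : Function.Surjective cls
  code_definable : M.Definable code
  le_definable : M.Definable₂
    (fun X Y => ∃ (hX : code X) (hY : code Y), cls ⟨X, hX⟩ ≤ cls ⟨Y, hY⟩)

/-- The elements of `M^𝔹`: sequences `bound → B` that are coded by a string of `M`, a code
of the `i`-th value being the `i`-th row of that string. Values outside the domain are set to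
`⊥`, so that `val i` is the Boolean value of `i ∈ A` for every number `i`. -/
structure BooleanAlgebraIn.Name {N : Type u} {S : Type v} {M : TwoSorted N S} {B : Type w}
    [BooleanAlgebra B] (R : BooleanAlgebraIn M B) where
  bound : N
  val : N → B
  val_eq_bot : ∀ i, ¬ M.lt i bound → val i = ⊥
  coded : ∃ X : S, ∀ i, M.lt i bound →
    ∃ (W : S) (hW : R.code W), M.IsRow X i W ∧ R.cls ⟨W, hW⟩ = val i

open Classical in
/-- The least upper bound of `s` (and `⊥` if there is none). -/
noncomputable def lubOf {B : Type w} [BooleanAlgebra B] (s : Set B) : B :=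
  if h : ∃ b, IsLUB s b then h.choose else ⊥

/-- The greatest lower bound of `s`, as the complement of the least upper bound of the
complements. -/
noncomputable def glbOf {B : Type w} [BooleanAlgebra B] (s : Set B) : B :=
  (lubOf (compl '' s))ᶜ

open Classical in
/-- The propositional translation of a `Σ₀ᴮ` formula `φ` for numbers `a` and strings of lengths
`n`, evaluated in `B` when the propositional variable for the `j`-th bit of the `i`-th string
has the value `p i j`. -/
noncomputable def SigmaB0.translate {N : Type u} {S : Type v} (M : TwoSorted N S) {B : Type w}
    [BooleanAlgebra B] :
    {k l : ℕ} → SigmaB0 k l → (Fin k → N) → (Fin l → N) → (Fin l → N → B) → B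
  | _, _, .le t u, a, n, _ => if M.le (t.eval M a n) (u.eval M a n) then ⊤ else ⊥
  | _, _, .eqNum t u, a, n, _ => if t.eval M a n = u.eval M a n then ⊤ else ⊥
  | _, _, .eqStr X Y, _, n, p =>
      if n X = n Y then
        glbOf {b | ∃ j, M.lt j (n X) ∧ b = (p X j ⊓ p Y j) ⊔ ((p X j)ᶜ ⊓ (p Y j)ᶜ)}
      else ⊥
  | _, _, .mem t X, a, n, p => if M.lt (t.eval M a n) (n X) then p X (t.eval M a n) else ⊥
  | _, _, .neg φ, a, n, p => (φ.translate M a n p)ᶜ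
  | _, _, .and φ ψ, a, n, p => φ.translate M a n p ⊓ ψ.translate M a n p
  | _, _, .or φ ψ, a, n, p => φ.translate M a n p ⊔ ψ.translate M a n p
  | _, _, .exLt t φ, a, n, p =>
      lubOf {b | ∃ j, M.lt j (t.eval M a n) ∧ b = φ.translate M (Fin.cons j a) n p}
  | _, _, .allLt t φ, a, n, p =>
      glbOf {b | ∃ j, M.lt j (t.eval M a n) ∧ b = φ.translate M (Fin.cons j a) n p}

open Classical in
/-- The Boolean value of `|A| = c` : the bit `c - 1` of `A` is set (no condition if `c = 0`),
and no bit `j` of `A` with `c ≤ j` is. -/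
noncomputable def BooleanAlgebraIn.Name.lenVal {N : Type u} {S : Type v} {M : TwoSorted N S}
    {B : Type w} [BooleanAlgebra B] {R : BooleanAlgebraIn M B} (A : R.Name) (c : N) : B :=
  (if h : ∃ j, M.succ j = c then A.val h.choose else ⊤) ⊓
    glbOf {b | ∃ j, M.le c j ∧ M.lt j A.bound ∧ b = (A.val j)ᶜ}

/-- The elements `⟦|A₁| = c₁⟧ ∧ … ∧ ⟦|A_l| = c_l⟧ ∧ ⟦φ⟧_{a,c}(A)`, one for each choice of
possible lengths `c` of the strings named by `A`. -/
def BooleanAlgebraIn.valueSet {N : Type u} {S : Type v} {M : TwoSorted N S} {B : Type w}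
    [BooleanAlgebra B] (R : BooleanAlgebraIn M B) {k l : ℕ} (φ : SigmaB0 k l) (a : Fin k → N)
    (A : Fin l → R.Name) : Set B :=
  {b | ∃ c : Fin l → N, (∀ i, M.le (c i) (A i).bound) ∧
    b = (Finset.univ.inf fun i => (A i).lenVal (c i)) ⊓
      φ.translate M a c (fun i => (A i).val)}

/-- The Boolean value `⟦φ(a, A)⟧`: the join, over all possible lengths `c` of the strings, of
the propositional translation for those lengths together with the statement that `c` are the
lengths. -/
noncomputable def BooleanAlgebraIn.bv {N : Type u} {S : Type v} {M : TwoSorted N S} {B : Type w}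
    [BooleanAlgebra B] (R : BooleanAlgebraIn M B) {k l : ℕ} (φ : SigmaB0 k l) (a : Fin k → N)
    (A : Fin l → R.Name) : B :=
  lubOf (R.valueSet φ a A)

/-- `B` admits a `Σ₀ᴮ`-translation: the joins that the propositional translations of `Σ₀ᴮ`
formulas ask for exist in `B`, the translations of the instances of a formula form a sequence
in `M^𝔹`, and the induction axiom for strings (`X(0)` and `X(i) → X(i+1)` for all `i < c`
imply `X(c)`) is valid in `B`. -/
structure BooleanAlgebraIn.AdmitsTranslation {N : Type u} {S : Type v} {M : TwoSorted N S}
    {B : Type w} [BooleanAlgebra B] (R : BooleanAlgebraIn M B) : Prop where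
  exists_lub : ∀ A : R.Name, ∃ b, IsLUB (A.val '' {i | M.lt i A.bound}) b
  exists_value : ∀ (k l : ℕ) (φ : SigmaB0 k l) (a : Fin k → N) (A : Fin l → R.Name),
    ∃ b, IsLUB (R.valueSet φ a A) b
  coded : ∀ (k l : ℕ) (φ : SigmaB0 (k + 1) l) (a : Fin k → N) (A : Fin l → R.Name)
    (n : Fin l → N), (∀ i, M.le (n i) (A i).bound) → ∀ c : N,
    ∃ Y : R.Name, Y.bound = c ∧
      ∀ j, M.lt j c → Y.val j = φ.translate M (Fin.cons j a) n (fun i => (A i).val)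
  induction : ∀ (A : R.Name) (c : N) (v : B), M.lt c A.bound → v ≤ A.val M.zero →
    (∀ i, M.lt i c → v ⊓ A.val i ≤ A.val (M.succ i)) → v ≤ A.val c

/-! ## Generic filters and the generic extension -/

/-- `M₀`-complete ideals: closed under joins of sequences that are coded in `M`. -/
def BooleanAlgebraIn.IsComplete {N : Type u} {S : Type v} {M : TwoSorted N S} {B : Type w}
    [BooleanAlgebra B] (R : BooleanAlgebraIn M B) (I : Order.Ideal B) : Prop :=
  ∀ A : R.Name, (∀ i, M.lt i A.bound → A.val i ∈ I) →
    ∀ b, IsLUB (A.val '' {i | M.lt i A.bound}) b → b ∈ I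

/-- A subset of `B` is definable if the set of codes of its elements is. -/
def BooleanAlgebraIn.DefinableSet {N : Type u} {S : Type v} {M : TwoSorted N S} {B : Type w}
    [BooleanAlgebra B] (R : BooleanAlgebraIn M B) (D : Set B) : Prop :=
  M.Definable (fun X => ∃ hX : R.code X, R.cls ⟨X, hX⟩ ∈ D)

/-- `D` is dense over `I`. -/
def DenseOver {B : Type w} [BooleanAlgebra B] (I : Order.Ideal B) (D : Set B) : Prop :=
  ∀ x, x ∉ I → ∃ y, y ∈ D ∧ y ∉ I ∧ y ≤ x

/-- `G` is generic over `I`: a proper filter that meets `D \ I` for every definable `D` that is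
dense over `I`. -/
def BooleanAlgebraIn.IsGeneric {N : Type u} {S : Type v} {M : TwoSorted N S} {B : Type w}
    [BooleanAlgebra B] (R : BooleanAlgebraIn M B) (I : Order.Ideal B) (G : Order.PFilter B) :
    Prop :=
  ⊥ ∉ G ∧ ∀ D : Set B, R.DefinableSet D → DenseOver I D → ∃ x, x ∈ D ∧ x ∉ I ∧ x ∈ G

/-- `i_G(A) = {y < a : A(y) ∈ G}` for `A : a → B`. -/
def BooleanAlgebraIn.Name.interp {N : Type u} {S : Type v} {M : TwoSorted N S} {B : Type w}
    [BooleanAlgebra B] {R : BooleanAlgebraIn M B} (A : R.Name) (G : Order.PFilter B) : Set N :=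
  {y | M.lt y A.bound ∧ A.val y ∈ G}

/-- `n` is the length of the set `T` of numbers: the least strict upper bound of `T`. -/
def TwoSorted.IsLength {N : Type u} {S : Type v} (M : TwoSorted N S) (T : Set N) (n : N) : Prop :=
  (∀ y, y ∈ T → M.lt y n) ∧ ∀ m, (∀ y, y ∈ T → M.lt y m) → M.le n m

/-- The string sort `M[G]` of the generic extension. -/
def BooleanAlgebraIn.Ext {N : Type u} {S : Type v} {M : TwoSorted N S} {B : Type w}
    [BooleanAlgebra B] (R : BooleanAlgebraIn M B) (G : Order.PFilter B) : Type u :=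
  {T : Set N // ∃ A : R.Name, T = A.interp G}

/-- The element `i_G(A)` of `M[G]`. -/
def BooleanAlgebraIn.iG {N : Type u} {S : Type v} {M : TwoSorted N S} {B : Type w}
    [BooleanAlgebra B] (R : BooleanAlgebraIn M B) (G : Order.PFilter B) (A : R.Name) : R.Ext G :=
  ⟨A.interp G, A, rfl⟩

open Classical in
/-- The two-sorted structure `(M₀, M[G])`: the numbers are those of `M`, strings are sets of
numbers, and the length is the least strict upper bound. -/
noncomputable def BooleanAlgebraIn.extension {N : Type u} {S : Type v} {M : TwoSorted N S}
    {B : Type w} [BooleanAlgebra B] (R : BooleanAlgebraIn M B) (G : Order.PFilter B) :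
    TwoSorted N (R.Ext G) where
  zero := M.zero
  succ := M.succ
  add := M.add
  mul := M.mul
  le := M.le
  len T := if h : ∃ n, M.IsLength T.1 n then h.choose else M.zero
  mem y T := y ∈ T.1

/-! The heart of the matter is that a generic filter decides joins of coded sequences. If `b` is the
join of `A`, the elements lying below `bᶜ` or below some `A(i)` form a definable set. It is dense
over `I`: an `x` with nothing of that set outside `I` below it would have `x ⊓ bᶜ` and all `x ⊓
A(i)` in `I`, hence also `x ⊓ b` by completeness, hence `x` itself. So `G` contains `bᶜ` or some
`A(i)` (`compl_mem_or_exists_mem`). One-term sequences make `G` an ultrafilter, and then `b ∈ G`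
exactly when some `A(i) ∈ G` (`isLUB_mem_iff`).

The instances of a `Σ₀ᴮ` formula form a coded sequence, so `G` commutes with bounded quantifiers as
well as connectives. Induction on the formula identifies truth in the extension with membership in
`G` of the translation at the actual lengths (`sat_iff_translate_mem`).

That these lengths exist is a least number principle in the extension. It comes from string
induction in the Boolean algebra, carried over to `G` (`IsGeneric.induction`, `exists_isLength`).

Finally, the join over all length tuples is not assumed to be the join of a coded sequence. Since
Boolean values of different lengths are disjoint, only its term at the actual lengths can matter to
`G` (`bv_mem_iff`). -/

/-! ## Renaming of variables -/

section Rename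

variable {N : Type u} {S : Type v}

def NumTerm.rename : {k l k' l' : ℕ} → NumTerm k l → (Fin k → Fin k') → (Fin l → Fin l') →
    NumTerm k' l'
  | _, _, _, _, .var x, f, _ => .var (f x)
  | _, _, _, _, .len X, _, g => .len (g X)
  | _, _, _, _, .zero, _, _ => .zero
  | _, _, _, _, .succ t, f, g => .succ (t.rename f g)
  | _, _, _, _, .add t u, f, g => .add (t.rename f g) (u.rename f g)
  | _, _, _, _, .mul t u, f, g => .mul (t.rename f g) (u.rename f g)

/-- Extension of a renaming to one more bound variable. -/
def liftRenaming {k k' : ℕ} (f : Fin k → Fin k') : Fin (k + 1) → Fin (k' + 1) :=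
  Fin.cons 0 (fun i => (f i).succ)

def SigmaB0.rename : {k l k' l' : ℕ} → SigmaB0 k l → (Fin k → Fin k') → (Fin l → Fin l') →
    SigmaB0 k' l'
  | _, _, _, _, .le t u, f, g => .le (t.rename f g) (u.rename f g)
  | _, _, _, _, .eqNum t u, f, g => .eqNum (t.rename f g) (u.rename f g)
  | _, _, _, _, .eqStr X Y, _, g => .eqStr (g X) (g Y)
  | _, _, _, _, .mem t X, f, g => .mem (t.rename f g) (g X)
  | _, _, _, _, .neg φ, f, g => .neg (φ.rename f g)
  | _, _, _, _, .and φ ψ, f, g => .and (φ.rename f g) (ψ.rename f g)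
  | _, _, _, _, .or φ ψ, f, g => .or (φ.rename f g) (ψ.rename f g)
  | _, _, _, _, .exLt t φ, f, g => .exLt (t.rename f g) (φ.rename (liftRenaming f) g)
  | _, _, _, _, .allLt t φ, f, g => .allLt (t.rename f g) (φ.rename (liftRenaming f) g)

def Formula2.rename : {k l k' l' : ℕ} → Formula2 k l → (Fin k → Fin k') → (Fin l → Fin l') →
    Formula2 k' l'
  | _, _, _, _, .base φ, f, g => .base (φ.rename f g)
  | _, _, _, _, .neg φ, f, g => .neg (φ.rename f g)
  | _, _, _, _, .and φ ψ, f, g => .and (φ.rename f g) (ψ.rename f g)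
  | _, _, _, _, .or φ ψ, f, g => .or (φ.rename f g) (ψ.rename f g)
  | _, _, _, _, .exNum φ, f, g => .exNum (φ.rename (liftRenaming f) g)
  | _, _, _, _, .allNum φ, f, g => .allNum (φ.rename (liftRenaming f) g)
  | _, _, _, _, .exStr φ, f, g => .exStr (φ.rename f (liftRenaming g))
  | _, _, _, _, .allStr φ, f, g => .allStr (φ.rename f (liftRenaming g))

theorem cons_liftRenaming {α : Type*} {k k' : ℕ} (f : Fin k → Fin k') (x : α) (a : Fin k' → α) :
    (fun i => (Fin.cons x a : Fin (k' + 1) → α) (liftRenaming f i)) =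
      (Fin.cons x (fun i => a (f i)) : Fin (k + 1) → α) := by
  funext i
  refine Fin.cases ?_ (fun i => ?_) i <;> simp [liftRenaming]

theorem NumTerm.eval_rename (M : TwoSorted N S) {k l k' l' : ℕ} (t : NumTerm k l)
    (f : Fin k → Fin k') (g : Fin l → Fin l') (a : Fin k' → N) (n : Fin l' → N) :
    (t.rename f g).eval M a n = t.eval M (fun i => a (f i)) (fun i => n (g i)) := by
  induction t <;> simp_all [NumTerm.rename, NumTerm.eval]

theorem SigmaB0.sat_rename (M : TwoSorted N S) {k l k' l' : ℕ} (φ : SigmaB0 k l)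
    (f : Fin k → Fin k') (g : Fin l → Fin l') (a : Fin k' → N) (A : Fin l' → S) :
    (φ.rename f g).Sat M a A ↔ φ.Sat M (fun i => a (f i)) (fun i => A (g i)) := by
  induction φ generalizing k' <;>
    simp_all [SigmaB0.rename, SigmaB0.Sat, NumTerm.eval_rename, cons_liftRenaming]

theorem Formula2.sat_rename (M : TwoSorted N S) {k l k' l' : ℕ} (φ : Formula2 k l)
    (f : Fin k → Fin k') (g : Fin l → Fin l') (a : Fin k' → N) (A : Fin l' → S) :
    (φ.rename f g).Sat M a A ↔ φ.Sat M (fun i => a (f i)) (fun i => A (g i)) := by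
  induction φ generalizing k' l' <;>
    simp_all [Formula2.rename, Formula2.Sat, SigmaB0.sat_rename, cons_liftRenaming]

end Rename

/-- The `Σ₀ᴮ` formula `t < u`. -/
def SigmaB0.lt {k l : ℕ} (t u : NumTerm k l) : SigmaB0 k l :=
  .and (.le t u) (.neg (.eqNum t u))

/-- The term `⟨t, u⟩`. -/
def NumTerm.pair {k l : ℕ} (t u : NumTerm k l) : NumTerm k l :=
  .add (.mul (.add t u) (.succ (.add t u))) (.add u u)

theorem NumTerm.eval_pair {N : Type u} {S : Type v} (M : TwoSorted N S) {k l : ℕ}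
    (t u : NumTerm k l) (a : Fin k → N) (n : Fin l → N) :
    (NumTerm.pair t u).eval M a n = M.pair (t.eval M a n) (u.eval M a n) := by
  simp [NumTerm.pair, NumTerm.eval, TwoSorted.pair]

/-! ## Arithmetic in models of `V⁰` -/

namespace TwoSorted

variable {N : Type u} {S : Type v} {M : TwoSorted N S}

namespace IsModelV0

theorem le_refl (hM : M.IsModelV0) (x : N) : M.le x x :=
  (hM.le_total x x).elim id id

theorem lt_succ_iff (hM : M.IsModelV0) {x y : N} : M.lt x (M.succ y) ↔ M.le x y :=
  (hM.le_iff_lt_succ x y).symm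

theorem lt_succ_self (hM : M.IsModelV0) (x : N) : M.lt x (M.succ x) :=
  hM.lt_succ_iff.2 (hM.le_refl x)

theorem le_succ (hM : M.IsModelV0) {x y : N} (h : M.le x y) : M.le x (M.succ y) :=
  (hM.lt_succ_iff.2 h).1

theorem not_lt_zero (hM : M.IsModelV0) (x : N) : ¬ M.lt x M.zero :=
  fun h => h.2 (hM.le_antisymm _ _ h.1 (hM.zero_le x))

theorem eq_zero_of_le (hM : M.IsModelV0) {x : N} (h : M.le x M.zero) : x = M.zero :=
  hM.le_antisymm _ _ h (hM.zero_le x)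

theorem lt_one_iff (hM : M.IsModelV0) {x : N} : M.lt x (M.succ M.zero) ↔ x = M.zero :=
  ⟨fun h => hM.eq_zero_of_le (hM.lt_succ_iff.1 h), fun h => h ▸ hM.lt_succ_self _⟩

theorem le_succ_cases (hM : M.IsModelV0) {x y : N} (h : M.le x (M.succ y)) :
    x = M.succ y ∨ M.le x y := by
  by_cases e : x = M.succ y
  · exact Or.inl e
  · exact Or.inr (hM.lt_succ_iff.1 ⟨h, e⟩)

theorem eq_zero_or_succ (hM : M.IsModelV0) (x : N) : x = M.zero ∨ ∃ y, M.succ y = x := by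
  by_cases h : x = M.zero
  · exact Or.inl h
  · obtain ⟨y, -, hy⟩ := hM.exists_pred x h
    exact Or.inr ⟨y, hy⟩

theorem le_of_succ_le_succ (hM : M.IsModelV0) {x y : N} (h : M.le (M.succ x) (M.succ y)) :
    M.le x y := by
  rcases hM.le_succ_cases h with e | h'
  · exact hM.succ_inj _ _ e ▸ hM.le_refl x
  · rcases hM.le_total x y with h1 | h1
    · exact h1
    · exact absurd (hM.le_antisymm _ _ (hM.le_succ h1) h') (hM.lt_succ_iff.2 h1).2

/-- Induction for `Σ₀ᴮ` formulas. -/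
theorem sigmaB0_induction (hM : M.IsModelV0) {k l : ℕ} (φ : SigmaB0 (k + 1) l) (a : Fin k → N)
    (A : Fin l → S) (h0 : φ.Sat M (Fin.cons M.zero a) A)
    (hs : ∀ x, φ.Sat M (Fin.cons x a) A → φ.Sat M (Fin.cons (M.succ x) a) A) (x : N) :
    φ.Sat M (Fin.cons x a) A := by
  -- `X` collects the `z ≤ x` such that `φ` holds on all of `[0, z]`. Its last element `p` is the
  -- predecessor of its length; `φ` then holds up to `p + 1`, which would be a further element of
  -- `X` unless `p = x`. The argument avoids transitivity of the order, which is itself proved by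
  -- this induction.
  obtain ⟨X, hle, hX⟩ := hM.comprehension k l
    (.allLt (.succ (.var 0)) (φ.rename (Fin.cons 0 fun i => i.succ.succ) id)) a A (M.succ x)
  have key : ∀ z, M.lt z (M.succ x) →
      (M.mem z X ↔ ∀ y, M.le y z → φ.Sat M (Fin.cons y a) A) := by
    intro z hz
    rw [hX z hz]
    have e : ∀ y : N, (fun i => (Fin.cons y (Fin.cons z a : Fin (k + 1) → N) : Fin (k + 2) → N)
        ((Fin.cons 0 fun i => i.succ.succ : Fin (k + 1) → Fin (k + 2)) i)) =
        (Fin.cons y a : Fin (k + 1) → N) := by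
      intro y
      funext i
      refine Fin.cases ?_ (fun i => ?_) i <;> simp
    simp [SigmaB0.Sat, NumTerm.eval, SigmaB0.sat_rename, hM.lt_succ_iff, e]
  rcases hM.eq_zero_or_succ (M.len X) with hm | ⟨p, hp⟩
  · exfalso
    have := (key M.zero (hM.lt_succ_iff.2 (hM.zero_le x))).2
      (fun y hy => hM.eq_zero_of_le hy ▸ h0)
    exact hM.not_lt_zero _ (hm ▸ hM.lt_len _ _ this)
  · rw [← hp] at hle
    have hpx := hM.lt_succ_iff.2 (hM.le_of_succ_le_succ hle)
    have hpX := (key p hpx).1 (hM.mem_pred_len X p hp)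
    have hall : ∀ y, M.le y (M.succ p) → φ.Sat M (Fin.cons y a) A := by
      intro y hy
      rcases hM.le_succ_cases hy with rfl | hy
      · exact hs p (hpX p (hM.le_refl p))
      · exact hpX y hy
    by_cases e : M.succ p = M.succ x
    · exact hpX x (hM.succ_inj _ _ e ▸ hM.le_refl p)
    · have := hM.lt_len _ _ ((key _ ⟨hle, e⟩).2 hall)
      exact absurd hp this.2

/-- Transitivity is not among the basic axioms. It follows by induction on `z`, with the hypothesis
on `y` and `z` moved into the induction formula. -/
theorem le_trans (hM : M.IsModelV0) {x y z : N} (hxy : M.le x y) (hyz : M.le y z) :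
    M.le x z := by
  have := hM.sigmaB0_induction (k := 2) (l := 0)
    (.or (.neg (.le (.var 2) (.var 0))) (.le (.var 1) (.var 0))) ![x, y] Fin.elim0 ?_ ?_ z
  · simp [SigmaB0.Sat, NumTerm.eval] at this
    tauto
  · simp only [SigmaB0.Sat, NumTerm.eval]
    by_cases h : M.le y M.zero
    · have := hM.eq_zero_of_le h
      subst this
      exact Or.inr hxy
    · exact Or.inl h
  · intro z hz
    simp [SigmaB0.Sat, NumTerm.eval] at hz ⊢
    by_cases h : M.le y (M.succ z)
    · right
      rcases hM.le_succ_cases h with rfl | h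
      · exact hxy
      · exact hM.le_succ (hz.resolve_left (not_not_intro h))
    · exact Or.inl h

theorem lt_of_le_of_lt (hM : M.IsModelV0) {x y z : N} (h : M.le x y) (h' : M.lt y z) :
    M.lt x z :=
  ⟨hM.le_trans h h'.1, fun e => h'.2 (hM.le_antisymm _ _ h'.1 (e ▸ h))⟩

theorem lt_of_lt_of_le (hM : M.IsModelV0) {x y z : N} (h : M.lt x y) (h' : M.le y z) :
    M.lt x z :=
  ⟨hM.le_trans h.1 h', fun e => h.2 (hM.le_antisymm _ _ h.1 (e ▸ h'))⟩

theorem not_lt (hM : M.IsModelV0) {x y : N} : ¬ M.lt x y ↔ M.le y x := by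
  constructor
  · intro h
    rcases hM.le_total x y with h1 | h1
    · by_cases e : x = y
      · exact e ▸ hM.le_refl x
      · exact absurd ⟨h1, e⟩ h
    · exact h1
  · intro h h'
    exact h'.2 (hM.le_antisymm _ _ h'.1 h)

theorem succ_le_iff (hM : M.IsModelV0) {x y : N} : M.le (M.succ x) y ↔ M.lt x y := by
  constructor
  · exact hM.lt_of_lt_of_le (hM.lt_succ_self x)
  · intro h
    by_contra h'
    exact h.2 (hM.le_antisymm _ _ h.1 (hM.lt_succ_iff.1
      ((not_imp_comm.1 hM.not_lt.1) h')))

/-- Commutativity is not developed, so monotonicity on each side needs its own induction: on the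
larger number here, on the common summand in `add_le_add_right`. -/
theorem add_le_add_left (hM : M.IsModelV0) {x y : N} (h : M.le x y) (z : N) :
    M.le (M.add z x) (M.add z y) := by
  have := hM.sigmaB0_induction (k := 2) (l := 0)
    (.or (.neg (.le (.var 1) (.var 0))) (.le (.add (.var 2) (.var 1)) (.add (.var 2) (.var 0))))
    ![x, z] Fin.elim0 ?_ ?_ y
  · simp [SigmaB0.Sat, NumTerm.eval] at this
    tauto
  · simp only [SigmaB0.Sat, NumTerm.eval]
    by_cases h : M.le x M.zero
    · have := hM.eq_zero_of_le h
      subst this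
      exact Or.inr (hM.le_refl _)
    · exact Or.inl h
  · intro y hy
    simp [SigmaB0.Sat, NumTerm.eval] at hy ⊢
    by_cases h : M.le x (M.succ y)
    · right
      rcases hM.le_succ_cases h with rfl | h
      · exact hM.le_refl _
      · rw [hM.add_succ]
        exact hM.le_succ (hy.resolve_left (not_not_intro h))
    · exact Or.inl h

theorem add_le_add_right (hM : M.IsModelV0) {x y : N} (h : M.le x y) (z : N) :
    M.le (M.add x z) (M.add y z) := by
  have := hM.sigmaB0_induction (k := 2) (l := 0)
    (.le (.add (.var 1) (.var 0)) (.add (.var 2) (.var 0))) ![x, y] Fin.elim0 ?_ ?_ z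
  · simpa [SigmaB0.Sat, NumTerm.eval] using this
  · simpa [SigmaB0.Sat, NumTerm.eval, hM.add_zero] using h
  · intro z hz
    simp [SigmaB0.Sat, NumTerm.eval, hM.add_succ] at hz ⊢
    exact hM.succ_le_iff.2 (hM.lt_succ_iff.2 hz)

theorem add_le_add (hM : M.IsModelV0) {x y z t : N} (h : M.le x y) (h' : M.le z t) :
    M.le (M.add x z) (M.add y t) :=
  hM.le_trans (hM.add_le_add_right h z) (hM.add_le_add_left h' y)

theorem add_lt_add (hM : M.IsModelV0) {x y z t : N} (h : M.le x y) (h' : M.lt z t) :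
    M.lt (M.add x z) (M.add y t) := by
  rw [← hM.succ_le_iff, ← hM.add_succ]
  exact hM.add_le_add h (hM.succ_le_iff.2 h')

theorem mul_le_mul_left (hM : M.IsModelV0) {x y : N} (h : M.le x y) (z : N) :
    M.le (M.mul z x) (M.mul z y) := by
  have := hM.sigmaB0_induction (k := 2) (l := 0)
    (.or (.neg (.le (.var 1) (.var 0))) (.le (.mul (.var 2) (.var 1)) (.mul (.var 2) (.var 0))))
    ![x, z] Fin.elim0 ?_ ?_ y
  · simp [SigmaB0.Sat, NumTerm.eval] at this
    tauto
  · simp only [SigmaB0.Sat, NumTerm.eval]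
    by_cases h : M.le x M.zero
    · have := hM.eq_zero_of_le h
      subst this
      exact Or.inr (hM.le_refl _)
    · exact Or.inl h
  · intro y hy
    simp [SigmaB0.Sat, NumTerm.eval] at hy ⊢
    by_cases h : M.le x (M.succ y)
    · right
      rcases hM.le_succ_cases h with rfl | h
      · exact hM.le_refl _
      · rw [hM.mul_succ]
        exact hM.le_trans (hy.resolve_left (not_not_intro h)) (hM.le_add _ _)
    · exact Or.inl h

theorem mul_le_mul_right (hM : M.IsModelV0) {x y : N} (h : M.le x y) (z : N) :
    M.le (M.mul x z) (M.mul y z) := by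
  have := hM.sigmaB0_induction (k := 2) (l := 0)
    (.le (.mul (.var 1) (.var 0)) (.mul (.var 2) (.var 0))) ![x, y] Fin.elim0 ?_ ?_ z
  · simpa [SigmaB0.Sat, NumTerm.eval] using this
  · simpa [SigmaB0.Sat, NumTerm.eval, hM.mul_zero] using hM.le_refl M.zero
  · intro z hz
    simp [SigmaB0.Sat, NumTerm.eval, hM.mul_succ] at hz ⊢
    exact hM.add_le_add hz h

/-- The product in the pairing function is weakly monotone; strictness comes from the summand `j +
j`. A fixed first coordinate suffices, because only the entries of a single row are ever compared.
-/
theorem pair_lt_pair (hM : M.IsModelV0) (i : N) {j j' : N} (h : M.lt j j') :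
    M.lt (M.pair i j) (M.pair i j') := by
  have h1 := hM.add_le_add_left h.1 i
  exact hM.add_lt_add (hM.le_trans (hM.mul_le_mul_right h1 _)
    (hM.mul_le_mul_left (hM.succ_le_iff.2 (hM.lt_succ_iff.2 h1)) _)) (hM.add_lt_add h.1 h)

theorem pair_right_inj (hM : M.IsModelV0) {i j j' : N} (h : M.pair i j = M.pair i j') :
    j = j' := by
  by_contra e
  rcases hM.le_total j j' with h1 | h1
  · exact (hM.pair_lt_pair i ⟨h1, e⟩).2 h
  · exact (hM.pair_lt_pair i ⟨h1, Ne.symm e⟩).2 h.symm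

/-- Strings with the same elements are equal. -/
theorem ext_mem (hM : M.IsModelV0) {X Y : S} (h : ∀ i, M.mem i X ↔ M.mem i Y) : X = Y := by
  have aux : ∀ {X Y : S}, (∀ i, M.mem i X ↔ M.mem i Y) → M.le (M.len X) (M.len Y) := by
    intro X Y h
    rcases hM.eq_zero_or_succ (M.len X) with e | ⟨p, hp⟩
    · exact e ▸ hM.zero_le _
    · rw [← hp]
      exact hM.succ_le_iff.2 (hM.lt_len _ _ ((h p).1 (hM.mem_pred_len X p hp)))
  exact hM.ext X Y (hM.le_antisymm _ _ (aux h) (aux fun i => (h i).symm)) fun i _ => h i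

/-- Every string is a row of some string. -/
theorem exists_isRow (hM : M.IsModelV0) (W : S) (i : N) : ∃ X, M.IsRow X i W := by
  -- By monotonicity of pairing, `⟨i, |W|⟩` bounds every code `⟨i, j⟩` with `j` in `W`; the bound on
  -- the length of `X` excludes elements beyond it.
  obtain ⟨X, hle, hX⟩ := hM.comprehension 1 1
    (.exLt (.len 0) (.and (.mem (.var 0) 0) (.eqNum (.var 1) (.pair (.var 2) (.var 0)))))
    ![i] ![W] (M.pair i (M.len W))
  have key : ∀ z, M.lt z (M.pair i (M.len W)) →
      (M.mem z X ↔ ∃ j, M.lt j (M.len W) ∧ M.mem j W ∧ z = M.pair i j) := by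
    intro z hz
    rw [hX z hz]
    simp [SigmaB0.Sat, NumTerm.eval, NumTerm.eval_pair]
  refine ⟨X, fun j => ⟨fun hj => ?_, fun hj => ?_⟩⟩
  · have hlt := hM.lt_len _ _ hj
    exact (key _ (hM.pair_lt_pair i hlt)).2 ⟨j, hlt, hj, rfl⟩
  · obtain ⟨j', -, hj', e⟩ := (key _ (hM.lt_of_lt_of_le (hM.lt_len _ _ hj) hle)).1 hj
    exact hM.pair_right_inj e ▸ hj'

end IsModelV0
end TwoSorted

/-! ## Joins of sequences in `M^𝔹` -/

theorem lubOf_eq {B : Type w} [BooleanAlgebra B] {s : Set B} {b : B} (h : IsLUB s b) :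
    lubOf s = b := by
  have h' : ∃ b, IsLUB s b := ⟨b, h⟩
  rw [lubOf, dif_pos h']
  exact h'.choose_spec.unique h

namespace BooleanAlgebraIn

variable {N : Type u} {S : Type v} {B : Type w} [BooleanAlgebra B] {M : TwoSorted N S}
  {R : BooleanAlgebraIn M B} {I : Order.Ideal B} {G : Order.PFilter B}

/-- The sequence of length one with value `x`. -/
theorem exists_singleton (R : BooleanAlgebraIn M B) (hM : M.IsModelV0) (x : B) :
    ∃ A : R.Name, A.bound = M.succ M.zero ∧ A.val M.zero = x := by
  classical
  obtain ⟨⟨W, hW⟩, rfl⟩ := R.surjective x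
  obtain ⟨X, hX⟩ := hM.exists_isRow W M.zero
  refine ⟨⟨M.succ M.zero, fun i => if i = M.zero then R.cls ⟨W, hW⟩ else ⊥, fun i hi => ?_,
    X, fun i hi => ?_⟩, rfl, if_pos rfl⟩
  · exact if_neg fun e => hi (hM.lt_one_iff.2 e)
  · obtain rfl := hM.lt_one_iff.1 hi
    exact ⟨W, hW, hX, (if_pos rfl).symm⟩

/-- The set of elements below `c` or below a member of the sequence `A` is definable. -/
theorem definableSet_below (R : BooleanAlgebraIn M B) (hM : M.IsModelV0) (A : R.Name) (c : B) :
    R.DefinableSet {x | x ≤ c ∨ ∃ i, M.lt i A.bound ∧ x ≤ A.val i} := by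
  obtain ⟨⟨C, hC⟩, rfl⟩ := R.surjective c
  obtain ⟨Z, hZ⟩ := A.coded
  obtain ⟨k, l, φ, a, P, hφ⟩ := R.le_definable
  -- The string parameters are a code `Z` of the sequence, a code `C` of `c`, and the parameters `P`
  -- of the preorder. Under the quantifiers the strings read `W, X, Z, C, P`; the formula says that
  -- `W` is row `i` of `Z` and that `X` is below `W`.
  refine ⟨k + 1, l + 2,
    .or (φ.rename Fin.succ (Fin.cons 0 (Fin.cons 2 fun i => i.succ.succ.succ)))
      (.exNum (.and (.base (.lt (.var 0) (.var 1)))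
        (.exStr (.and (.allNum (.base (.or
            (.and (.mem (.var 0) 0) (.mem (.pair (.var 1) (.var 0)) 2))
            (.and (.neg (.mem (.var 0) 0)) (.neg (.mem (.pair (.var 1) (.var 0)) 2))))))
          (φ.rename (fun i => i.succ.succ)
            (Fin.cons 1 (Fin.cons 0 fun i => i.succ.succ.succ.succ))))))),
    Fin.cons A.bound a, Fin.cons Z (Fin.cons C P), fun X => ?_⟩
  have e1 : ∀ X : S, (fun i => (Fin.cons X (Fin.cons Z (Fin.cons C P)) : Fin (l + 3) → S)
      ((Fin.cons 0 (Fin.cons 2 fun i => i.succ.succ.succ) : Fin (l + 2) → Fin (l + 3)) i)) =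
      Fin.cons X (Fin.cons C P) := by
    intro X
    funext i
    refine Fin.cases rfl (fun i => Fin.cases rfl (fun i => ?_) i) i
    simp
  have e2 : ∀ X W : S,
      (fun i => (Fin.cons W (Fin.cons X (Fin.cons Z (Fin.cons C P))) : Fin (l + 4) → S)
      ((Fin.cons 1 (Fin.cons 0 fun i => i.succ.succ.succ.succ) : Fin (l + 2) → Fin (l + 4)) i)) =
      Fin.cons X (Fin.cons W P) := by
    intro X W
    funext i
    refine Fin.cases rfl (fun i => Fin.cases rfl (fun i => ?_) i) i
    simp
  have v2 : ∀ X W : S,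
      (Fin.cons W (Fin.cons X (Fin.cons Z (Fin.cons C P))) : Fin (l + 4) → S) 2 = Z :=
    fun X W => rfl
  have hrow : ∀ (i : N) (W : S),
      (∀ x, M.mem x W ∧ M.mem (M.pair i x) Z ∨ ¬ M.mem x W ∧ ¬ M.mem (M.pair i x) Z) ↔
        M.IsRow Z i W :=
    fun i W => forall_congr' fun x => (iff_iff_and_or_not_and_not).symm
  simp only [Formula2.Sat, Formula2.sat_rename, e1, e2, SigmaB0.lt, SigmaB0.Sat, NumTerm.eval,
    NumTerm.eval_pair, Fin.cons_succ, Fin.cons_zero, Fin.cons_one, v2, hrow, ← hφ,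
    Set.mem_ofPred_eq]
  constructor
  · rintro ⟨hX, h | ⟨i, hi, h⟩⟩
    · exact Or.inl ⟨hX, hC, h⟩
    · obtain ⟨W, hW, hr, e⟩ := hZ i hi
      exact Or.inr ⟨i, hi, W, hr, hX, hW, e ▸ h⟩
  · rintro (⟨hX, hC, h⟩ | ⟨i, hi, W, hr, hX, hW, h⟩)
    · exact ⟨hX, Or.inl h⟩
    · obtain ⟨W', hW', hr', e⟩ := hZ i hi
      -- Rows are unique by extensionality, so the quantified string is the code supplied by the
      -- name.
      obtain rfl : W = W' := hM.ext_mem fun j => (hr j).trans (hr' j).symm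
      exact ⟨hX, Or.inr ⟨i, hi, e ▸ h⟩⟩

/-- The meet of a sequence with a fixed element. -/
theorem AdmitsTranslation.exists_inf (hR : R.AdmitsTranslation) (hM : M.IsModelV0) (A : R.Name)
    (x : B) : ∃ Y : R.Name, Y.bound = A.bound ∧ ∀ j, M.lt j A.bound → Y.val j = x ⊓ A.val j := by
  obtain ⟨C, hCb, hC⟩ := R.exists_singleton hM x
  -- The fixed element enters as bit `0` of a second string, so the meets are instances of `C(0) ∧
  -- A(j)`.
  obtain ⟨Y, hb, hY⟩ := hR.coded 0 2 (.and (.mem .zero 1) (.mem (.var 0) 0)) Fin.elim0 ![A, C]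
    (fun i => (![A, C] i).bound) (fun i => hM.le_refl _) A.bound
  refine ⟨Y, hb, fun j hj => ?_⟩
  rw [hY j hj]
  have : M.lt M.zero C.bound := hCb ▸ hM.lt_succ_self _
  simp [SigmaB0.translate, NumTerm.eval, hj, this, hC]

/-! ### Generic filters as ultrafilters that decide coded joins -/

namespace IsGeneric

/-- The only direct use of density: `G` meets the definable set of elements below `bᶜ` or below some
`A(i)`, and is upward closed. -/
theorem compl_mem_or_exists_mem (hG : R.IsGeneric I G) (hM : M.IsModelV0)
    (hR : R.AdmitsTranslation) (hI : R.IsComplete I) (A : R.Name) {b : B}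
    (hb : IsLUB (A.val '' {i | M.lt i A.bound}) b) :
    bᶜ ∈ G ∨ ∃ i, M.lt i A.bound ∧ A.val i ∈ G := by
  obtain ⟨x, hx, -, hxG⟩ := hG.2 _ (R.definableSet_below hM A bᶜ) (by
    intro x hx
    by_contra! h
    have h1 : x ⊓ bᶜ ∈ I := by
      by_contra h1
      exact h _ (Or.inl inf_le_right) h1 inf_le_left
    have h2 : x ⊓ b ∈ I := by
      obtain ⟨Y, hYb, hY⟩ := hR.exists_inf hM A x
      refine hI Y (fun i hi => ?_) _ ⟨?_, fun z hz => ?_⟩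
      · rw [hYb] at hi
        rw [hY i hi]
        by_contra h2
        exact h _ (Or.inr ⟨i, hi, inf_le_right⟩) h2 inf_le_left
      · rintro _ ⟨i, hi, rfl⟩
        rw [Set.mem_ofPred_eq, hYb] at hi
        rw [hY i hi]
        exact inf_le_inf_left _ (hb.1 ⟨i, hi, rfl⟩)
      -- Distributivity over the join, via the adjunction of meet and implication: `x ⊓ b` is the
      -- least upper bound of the `x ⊓ A(i)`.
      · rw [inf_comm, ← le_himp_iff]
        refine hb.2 ?_
        rintro _ ⟨i, hi, rfl⟩
        rw [le_himp_iff, inf_comm, ← hY i hi]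
        exact hz ⟨i, by rwa [Set.mem_ofPred_eq, hYb], rfl⟩
    refine hx ?_
    have : x = (x ⊓ b) ⊔ (x ⊓ bᶜ) := by rw [← inf_sup_left, sup_compl_eq_top, inf_top_eq]
    rw [this]
    exact Order.Ideal.sup_mem h2 h1)
  rcases hx with hx | ⟨i, hi, hx⟩
  · exact Or.inl (Order.PFilter.mem_of_le hx hxG)
  · exact Or.inr ⟨i, hi, Order.PFilter.mem_of_le hx hxG⟩

theorem not_compl_mem (hG : R.IsGeneric I G) {b : B} (h : b ∈ G) : bᶜ ∉ G := by
  intro h'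
  apply hG.1
  rw [← inf_compl_eq_bot (a := b)]
  exact Order.PFilter.inf_mem h h'

/-- The ultrafilter property is the case of a one-term sequence. -/
theorem compl_mem_iff (hG : R.IsGeneric I G) (hM : M.IsModelV0)
    (hR : R.AdmitsTranslation) (hI : R.IsComplete I) (b : B) : bᶜ ∈ G ↔ b ∉ G := by
  refine ⟨fun h h' => hG.not_compl_mem h' h, fun h => ?_⟩
  obtain ⟨A, hAb, hA⟩ := R.exists_singleton hM b
  have hlub : IsLUB (A.val '' {i | M.lt i A.bound}) b := by
    have : {i | M.lt i A.bound} = {M.zero} := by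
      ext i
      simp [hAb, hM.lt_one_iff]
    rw [this, Set.image_singleton, hA]
    exact isLUB_singleton
  rcases hG.compl_mem_or_exists_mem hM hR hI A hlub with h1 | ⟨i, hi, h1⟩
  · exact h1
  · rw [hAb, hM.lt_one_iff] at hi
    exact absurd (hA ▸ hi ▸ h1) h

theorem sup_mem_iff (hG : R.IsGeneric I G) (hM : M.IsModelV0)
    (hR : R.AdmitsTranslation) (hI : R.IsComplete I) (b c : B) :
    b ⊔ c ∈ G ↔ b ∈ G ∨ c ∈ G := by
  rw [← not_iff_not, ← hG.compl_mem_iff hM hR hI, compl_sup, Order.PFilter.inf_mem_iff,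
    hG.compl_mem_iff hM hR hI, hG.compl_mem_iff hM hR hI, not_or]

/-- A generic filter contains the join of a coded sequence iff it contains a member. -/
theorem isLUB_mem_iff (hG : R.IsGeneric I G) (hM : M.IsModelV0)
    (hR : R.AdmitsTranslation) (hI : R.IsComplete I) (A : R.Name) {b : B}
    (hb : IsLUB (A.val '' {i | M.lt i A.bound}) b) :
    b ∈ G ↔ ∃ i, M.lt i A.bound ∧ A.val i ∈ G := by
  constructor
  · intro h
    exact (hG.compl_mem_or_exists_mem hM hR hI A hb).resolve_left (hG.not_compl_mem h)
  · rintro ⟨i, hi, h⟩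
    exact Order.PFilter.mem_of_le (hb.1 ⟨i, hi, rfl⟩) h

end IsGeneric

/-! ### Bounded quantifiers and the generic filter -/

section Translate

variable {k l : ℕ} (φ : SigmaB0 (k + 1) l) (a : Fin k → N) (A : Fin l → R.Name) {n : Fin l → N}

/-- The values of a `Σ₀ᴮ` formula at the numbers below `c`. -/
def _root_.SigmaB0.instances (φ : SigmaB0 (k + 1) l) (a : Fin k → N) (A : Fin l → R.Name)
    (n : Fin l → N) (c : N) : Set B :=
  {b | ∃ j, M.lt j c ∧ b = φ.translate M (Fin.cons j a) n (fun i => (A i).val)}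

theorem AdmitsTranslation.exists_name (hR : R.AdmitsTranslation)
    (hn : ∀ i, M.le (n i) (A i).bound) (c : N) : ∃ Y : R.Name, Y.bound = c ∧
      (∀ j, M.lt j c → Y.val j = φ.translate M (Fin.cons j a) n (fun i => (A i).val)) ∧
      φ.instances a A n c = Y.val '' {i | M.lt i Y.bound} := by
  obtain ⟨Y, rfl, hY⟩ := hR.coded k l φ a A n hn c
  refine ⟨Y, rfl, hY, ?_⟩
  ext b
  constructor
  · rintro ⟨j, hj, rfl⟩
    exact ⟨j, hj, hY j hj⟩
  · rintro ⟨j, hj, rfl⟩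
    exact ⟨j, hj, hY j hj⟩

/-- The default value of `lubOf` never occurs for bounded quantifiers: the instances are the values
of a name, whose join exists. -/
theorem AdmitsTranslation.isLUB_lubOf (hR : R.AdmitsTranslation)
    (hn : ∀ i, M.le (n i) (A i).bound) (c : N) :
    IsLUB (φ.instances a A n c) (lubOf (φ.instances a A n c)) := by
  obtain ⟨Y, -, -, h⟩ := hR.exists_name φ a A hn c
  obtain ⟨b, hb⟩ := hR.exists_lub Y
  rw [← h] at hb
  rwa [lubOf_eq hb]

theorem IsGeneric.lubOf_mem_iff (hG : R.IsGeneric I G) (hM : M.IsModelV0)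
    (hR : R.AdmitsTranslation) (hI : R.IsComplete I) (hn : ∀ i, M.le (n i) (A i).bound) (c : N) :
    lubOf (φ.instances a A n c) ∈ G ↔
      ∃ j, M.lt j c ∧ φ.translate M (Fin.cons j a) n (fun i => (A i).val) ∈ G := by
  have hl := hR.isLUB_lubOf φ a A hn c
  obtain ⟨Y, rfl, hY, h⟩ := hR.exists_name φ a A hn c
  rw [h] at hl ⊢
  rw [hG.isLUB_mem_iff hM hR hI Y hl]
  exact exists_congr fun j => and_congr_right fun hj => by rw [hY j hj]

/-- Complements of instances of `φ` are instances of its negation, so the universal quantifier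
reduces to the existential one. -/
theorem glbOf_instances (c : N) :
    glbOf (φ.instances a A n c) = (lubOf (SigmaB0.instances (.neg φ) a A n c))ᶜ := by
  rw [glbOf]
  congr 2
  ext b
  constructor
  · rintro ⟨_, ⟨j, hj, rfl⟩, rfl⟩
    exact ⟨j, hj, rfl⟩
  · rintro ⟨j, hj, rfl⟩
    exact ⟨_, ⟨j, hj, rfl⟩, rfl⟩

theorem IsGeneric.glbOf_mem_iff (hG : R.IsGeneric I G) (hM : M.IsModelV0)
    (hR : R.AdmitsTranslation) (hI : R.IsComplete I) (hn : ∀ i, M.le (n i) (A i).bound) (c : N) :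
    glbOf (φ.instances a A n c) ∈ G ↔
      ∀ j, M.lt j c → φ.translate M (Fin.cons j a) n (fun i => (A i).val) ∈ G := by
  rw [glbOf_instances, hG.compl_mem_iff hM hR hI, hG.lubOf_mem_iff _ a A hM hR hI hn]
  simp only [SigmaB0.translate, hG.compl_mem_iff hM hR hI]
  push Not
  rfl

end Translate

end BooleanAlgebraIn

namespace TwoSorted

variable {N : Type u} {S : Type v} {M : TwoSorted N S}

theorem IsModelV0.isLength_unique (hM : M.IsModelV0) {T : Set N} {m n : N} (hm : M.IsLength T m)
    (hn : M.IsLength T n) : m = n :=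
  hM.le_antisymm _ _ (hm.2 n hn.1) (hn.2 m hm.1)

end TwoSorted

namespace BooleanAlgebraIn

variable {N : Type u} {S : Type v} {B : Type w} [BooleanAlgebra B] {M : TwoSorted N S}
  {R : BooleanAlgebraIn M B} {I : Order.Ideal B} {G : Order.PFilter B}

/-! ## Lengths in the generic extension -/

/-- A generic filter respects induction along a coded sequence. -/
theorem IsGeneric.induction (hG : R.IsGeneric I G) (hM : M.IsModelV0)
    (hR : R.AdmitsTranslation) (hI : R.IsComplete I) (Y : R.Name) {c : N}
    (hc : M.lt c Y.bound) (h0 : Y.val M.zero ∈ G)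
    (hs : ∀ i, M.lt i c → Y.val i ∈ G → Y.val (M.succ i) ∈ G) : Y.val c ∈ G := by
  -- `ψ(j)` says that the step at `j` fails. `G` contains no such value, hence not their join `x`;
  -- below `xᶜ` every step holds in the algebra, and string induction applies with `v = Y(0) ⊓ xᶜ`.
  let ψ : SigmaB0 1 1 := .and (.mem (.var 0) 0) (.neg (.mem (.succ (.var 0)) 0))
  have hn : ∀ i, M.le ((fun i => (![Y] i).bound) i) (![Y] i).bound := fun i => hM.le_refl _
  have hψ : ∀ j, M.lt j c → ψ.translate M (Fin.cons j Fin.elim0) (fun i => (![Y] i).bound)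
      (fun i => (![Y] i).val) = Y.val j ⊓ (Y.val (M.succ j))ᶜ := by
    intro j hj
    have h1 := hM.lt_of_le_of_lt (hM.succ_le_iff.2 hj) hc
    have h2 := hM.lt_of_le_of_lt hj.1 hc
    simp [ψ, SigmaB0.translate, NumTerm.eval, h1, h2]
  have hlub := hR.isLUB_lubOf ψ Fin.elim0 ![Y] hn c
  have hmem := hG.lubOf_mem_iff ψ Fin.elim0 ![Y] hM hR hI hn c
  generalize lubOf (ψ.instances Fin.elim0 ![Y] (fun i => (![Y] i).bound) c) = x at hlub hmem
  have hx : xᶜ ∈ G := by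
    rw [hG.compl_mem_iff hM hR hI, hmem]
    rintro ⟨j, hj, h⟩
    rw [hψ j hj, Order.PFilter.inf_mem_iff] at h
    exact hG.not_compl_mem (hs j hj h.1) h.2
  refine Order.PFilter.mem_of_le (hR.induction Y c (Y.val M.zero ⊓ xᶜ) hc inf_le_left
    fun i hi => ?_) (Order.PFilter.inf_mem h0 hx)
  have h1 : Y.val i ⊓ (Y.val (M.succ i))ᶜ ≤ x := hlub.1 ⟨i, hi, (hψ i hi).symm⟩
  have h2 : xᶜ ⊓ Y.val i ≤ Y.val (M.succ i) := by
    rw [inf_comm, ← sdiff_eq, sdiff_le_comm, sdiff_eq]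
    exact h1
  exact (inf_le_inf_right _ inf_le_right).trans h2

/-- Every string of the generic extension has a length. -/
theorem IsGeneric.exists_isLength (hG : R.IsGeneric I G) (hM : M.IsModelV0)
    (hR : R.AdmitsTranslation) (hI : R.IsComplete I) (A : R.Name) :
    ∃ n, M.IsLength (A.interp G) n := by
  by_cases hne : ∃ y, y ∈ A.interp G
  · obtain ⟨y, hy⟩ := hne
    have hn : ∀ i, M.le ((fun i => (![A] i).bound) i) (![A] i).bound := fun i => hM.le_refl _
    -- `Y(j)` is the value of "some `i ≥ j` lies in `A`". Its domain is one longer than that of `A`,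
    -- so that the induction can reach `A.bound`, where `Y` cannot be in `G`.
    let θ : SigmaB0 3 1 := .and (.le (.var 1) (.var 0)) (.mem (.var 0) 0)
    let φ : SigmaB0 2 1 := .exLt (.var 1) θ
    obtain ⟨Y, hYb, hY, -⟩ := hR.exists_name φ ![A.bound] ![A] hn (M.succ A.bound)
    have hYG : ∀ j, M.le j A.bound → (Y.val j ∈ G ↔ ∃ i, i ∈ A.interp G ∧ M.le j i) := by
      intro j hj
      rw [hY j (hM.lt_succ_iff.2 hj)]
      simp only [φ, SigmaB0.translate, NumTerm.eval]
      refine (hG.lubOf_mem_iff θ (Fin.cons j ![A.bound]) ![A] hM hR hI hn A.bound).trans ?_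
      refine exists_congr fun i => ?_
      by_cases h1 : M.le j i
      · by_cases h2 : M.lt i A.bound
        · simp [θ, SigmaB0.translate, NumTerm.eval, h1, h2, Name.interp]
        · simp [h2, Name.interp]
      · simp [θ, SigmaB0.translate, NumTerm.eval, h1, hG.1]
    by_contra hlen
    have := hG.induction hM hR hI Y (hYb ▸ hM.lt_succ_self A.bound)
      ((hYG _ (hM.zero_le _)).2 ⟨y, hy, hM.zero_le y⟩) (by
        intro i hi h
        rw [hYG i hi.1] at h
        rw [hYG _ (hM.succ_le_iff.2 hi)]
        obtain ⟨j, hj, hij⟩ := h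
        -- A step failing at `i` would make `i` the last element of the set, and `i + 1` its length.
        by_contra! h'
        have hall : ∀ z, z ∈ A.interp G → M.lt z (M.succ i) := fun z hz =>
          (not_imp_comm.1 hM.not_lt.1) (h' z hz)
        obtain rfl : j = i := hM.le_antisymm _ _ (hM.lt_succ_iff.1 (hall j hj)) hij
        exact hlen ⟨M.succ j, hall, fun m hm => hM.succ_le_iff.2 (hm j hj)⟩)
    obtain ⟨i, hi, h⟩ := (hYG _ (hM.le_refl _)).1 this
    exact hM.not_lt.2 h hi.1
  · exact ⟨M.zero, fun y hy => absurd ⟨y, hy⟩ hne, fun m _ => hM.zero_le m⟩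

theorem len_extension (hM : M.IsModelV0) (A : R.Name) {n : N} (h : M.IsLength (A.interp G) n) :
    (R.extension G).len (R.iG G A) = n := by
  have h' : ∃ n, M.IsLength (A.interp G) n := ⟨n, h⟩
  refine (dif_pos h').trans (hM.isLength_unique h'.choose_spec h)

theorem Name.le_bound {A : R.Name} {n : N} (h : M.IsLength (A.interp G) n) : M.le n A.bound :=
  h.2 _ fun _ hy => hy.1

/-! ## Truth in the generic extension -/

theorem eval_extension {k l : ℕ} (t : NumTerm k l) (a : Fin k → N) (n : Fin l → N) :
    t.eval (R.extension G) a n = t.eval M a n := by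
  induction t <;> simp_all [NumTerm.eval, extension]

theorem extension_lt (x y : N) : (R.extension G).lt x y ↔ M.lt x y := Iff.rfl

/-- A `Σ₀ᴮ` formula holds in the generic extension iff its propositional translation for the
lengths of the strings belongs to the generic filter. -/
theorem IsGeneric.sat_iff_translate_mem (hG : R.IsGeneric I G) (hM : M.IsModelV0)
    (hR : R.AdmitsTranslation) (hI : R.IsComplete I) {k l : ℕ} (φ : SigmaB0 k l)
    (a : Fin k → N) (A : Fin l → R.Name) (n : Fin l → N)
    (hn : ∀ i, M.IsLength ((A i).interp G) (n i)) :
    φ.Sat (R.extension G) a (fun i => R.iG G (A i)) ↔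
      φ.translate M a n (fun i => (A i).val) ∈ G := by
  have hlen : (fun i => (R.extension G).len (R.iG G (A i))) = n :=
    funext fun i => len_extension hM (A i) (hn i)
  have hb : ∀ i, M.le (n i) (A i).bound := fun i => Name.le_bound (hn i)
  induction φ with
  | le t u =>
    simp only [SigmaB0.Sat, SigmaB0.translate, hlen, eval_extension]
    change M.le _ _ ↔ _
    split_ifs with h <;> simp [h, hG.1]
  | eqNum t u =>
    simp only [SigmaB0.Sat, SigmaB0.translate, hlen, eval_extension]
    split_ifs with h <;> simp [h, hG.1]
  | @eqStr k l X Y =>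
    simp only [SigmaB0.Sat, SigmaB0.translate]
    split_ifs with h
    -- String equality is treated as a bounded universal quantifier over the `Σ₀ᴮ` formula `X(j) ↔
    -- Y(j)`.
    · let ψ : SigmaB0 (k + 1) l := .or (.and (.mem (.var 0) X) (.mem (.var 0) Y))
        (.and (.neg (.mem (.var 0) X)) (.neg (.mem (.var 0) Y)))
      have hψ : ∀ j, M.lt j (n X) → ψ.translate M (Fin.cons j a) n (fun i => (A i).val) =
          ((A X).val j ⊓ (A Y).val j) ⊔ (((A X).val j)ᶜ ⊓ ((A Y).val j)ᶜ) := by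
        intro j hj
        have hj' : M.lt j (n Y) := h ▸ hj
        simp [ψ, SigmaB0.translate, NumTerm.eval, hj, hj']
      have hset : {b | ∃ j, M.lt j (n X) ∧ b = ((A X).val j ⊓ (A Y).val j) ⊔
          (((A X).val j)ᶜ ⊓ ((A Y).val j)ᶜ)} = ψ.instances a A n (n X) := by
        ext b
        exact exists_congr fun j => and_congr_right fun hj => by rw [hψ j hj]
      rw [hset, hG.glbOf_mem_iff ψ a A hM hR hI hb]
      have hmem : ∀ j, M.lt j (n X) → (ψ.translate M (Fin.cons j a) n (fun i => (A i).val) ∈ G ↔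
          (j ∈ (A X).interp G ↔ j ∈ (A Y).interp G)) := by
        intro j hj
        have h1 := hM.lt_of_lt_of_le hj (hb X)
        have h2 := hM.lt_of_lt_of_le hj (h ▸ hb Y)
        rw [hψ j hj, hG.sup_mem_iff hM hR hI, Order.PFilter.inf_mem_iff,
          Order.PFilter.inf_mem_iff, hG.compl_mem_iff hM hR hI, hG.compl_mem_iff hM hR hI]
        simp only [Name.interp, Set.mem_ofPred_eq, h1, h2, true_and]
        tauto
      refine (Subtype.ext_iff.trans Set.ext_iff).trans ?_
      constructor
      · exact fun h' j hj => (hmem j hj).2 (h' j)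
      · intro h' j
        by_cases hj : M.lt j (n X)
        · exact (hmem j hj).1 (h' j hj)
        -- Past the common length neither set has elements, so agreement below it gives equality.
        · exact iff_of_false (fun h1 => hj ((hn X).1 j h1)) (fun h1 => hj (h ▸ (hn Y).1 j h1))
    · refine iff_of_false (fun h' => h ?_) hG.1
      have h1 := congrFun hlen X
      have h2 := congrFun hlen Y
      rw [← h1, ← h2, h']
  | mem t X =>
    simp only [SigmaB0.Sat, SigmaB0.translate, hlen, eval_extension]
    change _ ∈ (A X).interp G ↔ _
    split_ifs with h
    · exact and_iff_right (hM.lt_of_lt_of_le h (hb X))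
    · exact iff_of_false (fun h' => h ((hn X).1 _ h')) hG.1
  | neg φ ih =>
    simp only [SigmaB0.Sat, SigmaB0.translate]
    exact (not_congr (ih a A n hn hlen hb)).trans (hG.compl_mem_iff hM hR hI _).symm
  | and φ ψ ih₁ ih₂ =>
    simp only [SigmaB0.Sat, SigmaB0.translate]
    exact (and_congr (ih₁ a A n hn hlen hb) (ih₂ a A n hn hlen hb)).trans
      Order.PFilter.inf_mem_iff.symm
  | or φ ψ ih₁ ih₂ =>
    simp only [SigmaB0.Sat, SigmaB0.translate]
    exact (or_congr (ih₁ a A n hn hlen hb) (ih₂ a A n hn hlen hb)).trans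
      (hG.sup_mem_iff hM hR hI _ _).symm
  | exLt t φ ih =>
    simp only [SigmaB0.Sat, SigmaB0.translate, hlen, eval_extension, extension_lt]
    refine Iff.trans ?_ (hG.lubOf_mem_iff φ a A hM hR hI hb (t.eval M a n)).symm
    exact exists_congr fun j => and_congr_right fun _ => ih _ A n hn hlen hb
  | allLt t φ ih =>
    simp only [SigmaB0.Sat, SigmaB0.translate, hlen, eval_extension, extension_lt]
    refine Iff.trans ?_ (hG.glbOf_mem_iff φ a A hM hR hI hb (t.eval M a n)).symm
    exact forall_congr' fun j => imp_congr_right fun _ => ih _ A n hn hlen hb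

/-! ## Boolean values of lengths -/

/-- The bits from `c` on are not indexed by an initial segment. Putting `c ≤ j` into the formula
replaces the earlier bits by `⊥`, which leaves the join unchanged and makes the sequence coded. One
`b` serves both the purely algebraic disjointness argument and the generic one. -/
theorem AdmitsTranslation.exists_lenVal_eq (hR : R.AdmitsTranslation) (hM : M.IsModelV0)
    (A : R.Name) (c : N) : ∃ b, IsLUB {x | ∃ j, M.le c j ∧ M.lt j A.bound ∧ x = A.val j} b ∧
      glbOf {x | ∃ j, M.le c j ∧ M.lt j A.bound ∧ x = (A.val j)ᶜ} = bᶜ ∧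
      ∀ {I : Order.Ideal B} {G : Order.PFilter B}, R.IsGeneric I G → R.IsComplete I →
        (b ∈ G ↔ ∃ j, M.le c j ∧ j ∈ A.interp G) := by
  let θ : SigmaB0 2 1 := .and (.le (.var 1) (.var 0)) (.mem (.var 0) 0)
  have hn : ∀ i, M.le ((fun i => (![A] i).bound) i) (![A] i).bound := fun i => hM.le_refl _
  have hlub := hR.isLUB_lubOf θ ![c] ![A] hn A.bound
  have hmem : ∀ {I : Order.Ideal B} {G : Order.PFilter B}, R.IsGeneric I G → R.IsComplete I → _ :=
    fun hG hI => hG.lubOf_mem_iff θ ![c] ![A] hM hR hI hn A.bound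
  have hθ : ∀ j, M.lt j A.bound → M.le c j → θ.translate M (Fin.cons j ![c])
      (fun i => (![A] i).bound) (fun i => (![A] i).val) = A.val j := by
    intro j h1 h2
    simp [θ, SigmaB0.translate, NumTerm.eval, h1, h2]
  have hθ' : ∀ j, ¬ M.le c j → θ.translate M (Fin.cons j ![c])
      (fun i => (![A] i).bound) (fun i => (![A] i).val) = ⊥ := by
    intro j h2
    simp [θ, SigmaB0.translate, NumTerm.eval, h2]
  generalize lubOf (θ.instances ![c] ![A] (fun i => (![A] i).bound) A.bound) = b at hlub hmem
  have hb : IsLUB {x | ∃ j, M.le c j ∧ M.lt j A.bound ∧ x = A.val j} b := by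
    refine ⟨?_, fun z hz => hlub.2 ?_⟩
    · rintro _ ⟨j, h1, h2, rfl⟩
      exact hlub.1 ⟨j, h2, (hθ j h2 h1).symm⟩
    · rintro _ ⟨j, hj, rfl⟩
      by_cases h : M.le c j
      · rw [hθ j hj h]
        exact hz ⟨j, h, hj, rfl⟩
      · rw [hθ' j h]
        exact bot_le
  refine ⟨b, hb, ?_, ?_⟩
  · rw [glbOf]
    congr 1
    convert lubOf_eq hb using 2
    ext x
    constructor
    · rintro ⟨_, ⟨j, h1, h2, rfl⟩, rfl⟩
      exact ⟨j, h1, h2, compl_compl _⟩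
    · rintro ⟨j, h1, h2, rfl⟩
      exact ⟨_, ⟨j, h1, h2, rfl⟩, compl_compl _⟩
  · intro I G hG hI
    rw [hmem hG hI]
    refine exists_congr fun j => ?_
    by_cases h : M.le c j
    · by_cases h2 : M.lt j A.bound
      · rw [hθ j h2 h]
        simp [h, h2, Name.interp]
      · simp [h2, Name.interp]
    · rw [hθ' j h]
      simp [h, hG.1]

theorem lenVal_succ_le (hM : M.IsModelV0) (A : R.Name) (c : N) :
    A.lenVal (M.succ c) ≤ A.val c := by
  have h : ∃ j, M.succ j = M.succ c := ⟨c, rfl⟩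
  rw [Name.lenVal, dif_pos h, hM.succ_inj _ _ h.choose_spec]
  exact inf_le_left

theorem AdmitsTranslation.lenVal_le_compl (hR : R.AdmitsTranslation) (hM : M.IsModelV0)
    (A : R.Name) {c j : N} (h1 : M.le c j) (h2 : M.lt j A.bound) : A.lenVal c ≤ (A.val j)ᶜ := by
  obtain ⟨b, hb, e, -⟩ := hR.exists_lenVal_eq hM A c
  refine inf_le_right.trans ?_
  rw [e]
  exact compl_le_compl (hb.1 ⟨j, h1, h2, rfl⟩)

/-- Boolean values of different lengths are disjoint. -/
theorem AdmitsTranslation.disjoint_lenVal (hR : R.AdmitsTranslation) (hM : M.IsModelV0)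
    (A : R.Name) {c d : N} (hc : M.le c A.bound) (hd : M.le d A.bound) (hcd : c ≠ d) :
    Disjoint (A.lenVal c) (A.lenVal d) := by
  have aux : ∀ {c d : N}, M.le d A.bound → M.lt c d → Disjoint (A.lenVal c) (A.lenVal d) := by
    intro c d hd hcd
    rcases hM.eq_zero_or_succ d with rfl | ⟨j, rfl⟩
    · exact absurd hcd (hM.not_lt_zero c)
    · exact disjoint_compl_left.mono (hR.lenVal_le_compl hM A (hM.lt_succ_iff.1 hcd)
        (hM.succ_le_iff.1 hd)) (lenVal_succ_le hM A j)
  rcases hM.le_total c d with h | h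
  · exact aux hd ⟨h, hcd⟩
  · exact (aux hc ⟨h, hcd.symm⟩).symm

theorem IsGeneric.lenVal_mem (hG : R.IsGeneric I G) (hM : M.IsModelV0)
    (hR : R.AdmitsTranslation) (hI : R.IsComplete I) (A : R.Name) {c : N}
    (hc : M.IsLength (A.interp G) c) : A.lenVal c ∈ G := by
  refine Order.PFilter.inf_mem ?_ ?_
  · split_ifs with h
    · by_contra h'
      have hj := h.choose_spec
      generalize h.choose = j at hj h'
      subst hj
      refine (hM.lt_succ_self j).2 (hM.le_antisymm _ _ (hM.lt_succ_self j).1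
        (hc.2 j fun y hy => ⟨hM.lt_succ_iff.1 (hc.1 y hy), ?_⟩))
      rintro rfl
      exact h' hy.2
    · exact Order.PFilter.top_mem
  · obtain ⟨b, -, e, hb⟩ := hR.exists_lenVal_eq hM A c
    rw [e, hG.compl_mem_iff hM hR hI, hb hG hI]
    rintro ⟨j, h1, h2⟩
    exact hM.not_lt.2 h1 (hc.1 j h2)

/-- The Boolean value of a `Σ₀ᴮ` formula belongs to a generic filter iff its propositional
translation for the lengths of the strings does. -/
theorem IsGeneric.bv_mem_iff (hG : R.IsGeneric I G) (hM : M.IsModelV0)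
    (hR : R.AdmitsTranslation) (hI : R.IsComplete I) {k l : ℕ} (φ : SigmaB0 k l)
    (a : Fin k → N) (A : Fin l → R.Name) (n : Fin l → N)
    (hn : ∀ i, M.IsLength ((A i).interp G) (n i)) :
    R.bv φ a A ∈ G ↔ φ.translate M a n (fun i => (A i).val) ∈ G := by
  have hb : ∀ i, M.le (n i) (A i).bound := fun i => Name.le_bound (hn i)
  have hlen : (Finset.univ.inf fun i => (A i).lenVal (n i)) ∈ G :=
    Finset.inf_induction Order.PFilter.top_mem (fun _ h _ h' => Order.PFilter.inf_mem h h')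
      fun i _ => hG.lenVal_mem hM hR hI (A i) (hn i)
  obtain ⟨b, hlub⟩ := hR.exists_value k l φ a A
  rw [bv, lubOf_eq hlub]
  constructor
  · intro h
    by_contra h'
    rw [← hG.compl_mem_iff hM hR hI] at h'
    refine hG.not_compl_mem (Order.PFilter.inf_mem hlen h') (Order.PFilter.mem_of_le ?_ h)
    refine hlub.2 ?_
    rintro _ ⟨c, hc, rfl⟩
    rw [le_compl_iff_disjoint_right]
    by_cases e : c = n
    · subst e
      exact disjoint_compl_right.mono inf_le_right inf_le_right
    · obtain ⟨i, hi⟩ := Function.ne_iff.1 e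
      exact (hR.disjoint_lenVal hM (A i) (hc i) (hb i) hi).mono
        (inf_le_left.trans (Finset.inf_le (Finset.mem_univ i)))
        (inf_le_left.trans (Finset.inf_le (Finset.mem_univ i)))
  · intro h
    exact Order.PFilter.mem_of_le (hlub.1 ⟨n, hb, rfl⟩) (Order.PFilter.inf_mem hlen h)

end BooleanAlgebraIn

/-- Forcing theorem for `Σ₀ᴮ` formulas. The first part says that every string of `M[G]` has a
length, so that `(M₀, M[G])` is a two-sorted structure; the second is the forcing theorem; the
third is its form for strings `i_G(Aᵢ)` whose length is the length of the domain of `Aᵢ`, where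
the Boolean value is the propositional translation for the lengths of the domains. -/
theorem mainTheorem7 {N : Type*} {S : Type*} {B : Type*} [BooleanAlgebra B]
    (M : TwoSorted N S) (hM : M.IsModelV0)
    (R : BooleanAlgebraIn M B) (hR : R.AdmitsTranslation)
    (I : Order.Ideal B) (hI : ⊤ ∉ I) (hIc : R.IsComplete I)
    (G : Order.PFilter B) (hG : R.IsGeneric I G) :
    (∀ A : R.Name, ∃ n, M.IsLength (A.interp G) n) ∧
    (∀ (k l : ℕ) (φ : SigmaB0 k l) (a : Fin k → N) (A : Fin l → R.Name),
      φ.Sat (R.extension G) a (fun i => R.iG G (A i)) ↔ R.bv φ a A ∈ G) ∧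
    (∀ (k l : ℕ) (φ : SigmaB0 k l) (a : Fin k → N) (A : Fin l → R.Name),
      (∀ i, M.IsLength (A i |>.interp G) (A i).bound) →
      (φ.Sat (R.extension G) a (fun i => R.iG G (A i)) ↔
        φ.translate M a (fun i => (A i).bound) (fun i => (A i).val) ∈ G)) := by
  refine ⟨hG.exists_isLength hM hR hIc, fun k l φ a A => ?_, fun k l φ a A hA =>
    hG.sat_iff_translate_mem hM hR hIc φ a A _ hA⟩
  choose n hn using fun i => hG.exists_isLength hM hR hIc (A i)
  rw [hG.sat_iff_translate_mem hM hR hIc φ a A n hn, hG.bv_mem_iff hM hR hIc φ a A n hn]
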